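/- Let $(\mathbb{R},\mathbb{R},\mathcal{L})$ be a cut and project scheme, i.e. let $\mathcal{L}\subset\mathbb{R}\times\mathbb{R}$ be a lattice such that the projection $\pi$ to the first factor is injective on $\mathcal{L}$ and the image of $\mathcal{L}$ under the projection $\pi_{\mathrm{int}}$ to the second factor is dense in $\mathbb{R}$. Put $L=\pi(\mathcal{L})$, and let $\star\colon L\to\mathbb{R}$ be the star map, which sends $x\in L$ to the unique $x^\star\in\mathbb{R}$ with $(x,x^\star)\in\mathcal{L}$. Assume that $\mathcal{L}$ is self-dual, i.e. that $\mathcal{L}=\mathcal{L}^*=\{z\in\mathbb{R}^2 : z\cdot w\in\mathbb{Z}\text{ for all }w\in\mathcal{L}\}$. Let $0\neq g\in\mathcal{S}(\mathbb{R})$ be a Schwartz function with $\widehat{g}=\lambda g$ for some $\lambda\in\mathbb{C}$, where $\widehat{g}(y)=\int_{\mathbb{R}}\mathrm{e}^{-2\pi\mathrm{i}xy}g(x)\,\mathrm{d}x$. Then $\lambda\in\{1,\mathrm{i},-1,-\mathrm{i}\}$. Moreover, the sum in $$\omega_g(\varphi)=\sum_{x\in L}g(x^\star)\,\varphi(x)$$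 converges absolutely for every $\varphi\in C_{\mathsf{c}}(\mathbb{R})$, and $\omega_g=\sum_{x\in L}g(x^\star)\,\delta_x$ is an eigenmeasure of the Fourier transform $\mathcal{F}$ with eigenvalue $\overline{\lambda}$: it is a non-zero Radon measure that defines a tempered distribution, and $\mathcal{F}(\omega_g)=\overline{\lambda}\,\omega_g$ as tempered distributions. It is also an eigenmeasure with eigenvalue $\overline{\lambda}$ in the strict sense, i.e. $\omega_g$ is Fourier transformable as a measure with transform $\nu=\overline{\lambda}\,\omega_g$: for every $f\in C_{\mathsf{c}}(\mathbb{R})$, with $\widetilde{f}(x)=\overline{f(-x)}$ and $\widecheck{f}(y)=\int_{\mathbb{R}}\mathrm{e}^{2\pi\mathrm{i}xy}f(x)\,\mathrm{d}x$, the function $|\widecheck{f}|^2$ is $|\nu|$-integrable and $\omega_g(f*\widetilde{f})=\int_{\mathbb{R}}|\widecheck{f}|^2\,\mathrm{d}\nu$. -/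

import Mathlib

open scoped SchwartzMap CompactlySupported FourierTransform ComplexConjugate
open MeasureTheory

noncomputable section

namespace FourierEigenmeasure

/-! ### Radon measures on the real line -/

/-- A (complex) Radon measure on `ℝ`, viewed as a linear functional on `C_c(ℝ, ℂ)` that is
continuous for the inductive limit topology: for every compact `K` there is a constant `C` with
`|μ(φ)| ≤ C ‖φ‖_∞` for all `φ` supported in `K`. -/
structure IsRadonMeasure (μ : C_c(ℝ, ℂ) → ℂ) : Prop where
  isLinearMap : IsLinearMap ℂ μ
  bounded : ∀ K : Set ℝ, IsCompact K → ∃ C : ℝ, ∀ φ : C_c(ℝ, ℂ), tsupport φ ⊆ K →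
    ∀ M : ℝ, (∀ x, ‖φ x‖ ≤ M) → ‖μ φ‖ ≤ C * M

/-- `μ = u |μ|` is the polar decomposition of the Radon measure `μ`: its total variation is the
positive Borel measure `m`, and `u` is its unimodular density with respect to `m`. Every Radon
measure has such a decomposition; `m` is unique, and `u` is unique up to `m`-null sets. -/
structure IsPolarDecomposition (μ : C_c(ℝ, ℂ) → ℂ) (m : Measure ℝ) (u : ℝ → ℂ) : Prop where
  finite_on_compacts : IsFiniteMeasureOnCompacts m
  measurable_density : Measurable u
  norm_density : ∀ x, ‖u x‖ = 1
  apply_eq : ∀ φ : C_c(ℝ, ℂ), μ φ = ∫ x, φ x * u x ∂m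

/-! ### Fourier transform in the sense of tempered distributions -/

/-- The distribution defined by the measure `μ` is the tempered distribution `T`: they agree on
`C_c^∞(ℝ)`, that is, on the functions that are both Schwartz functions and of compact support. -/
def Represents (T : 𝓢'(ℝ, ℂ)) (μ : C_c(ℝ, ℂ) → ℂ) : Prop :=
  ∀ (f : 𝓢(ℝ, ℂ)) (φ : C_c(ℝ, ℂ)), (∀ x, f x = φ x) → T f = μ φ

/-- `μ` is a tempered Radon measure. -/
def IsTemperedMeasure (μ : C_c(ℝ, ℂ) → ℂ) : Prop :=
  IsRadonMeasure μ ∧ ∃ T : 𝓢'(ℝ, ℂ), Represents T μ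

/-- The tempered measure `μ` is Fourier transformable as a tempered distribution, and its
transform is the Radon measure `ν`. -/
def HasFourierTransform (μ ν : C_c(ℝ, ℂ) → ℂ) : Prop :=
  IsRadonMeasure μ ∧ IsRadonMeasure ν ∧
    ∃ T : 𝓢'(ℝ, ℂ), Represents T μ ∧ Represents (𝓕 T) ν

/-- `μ` is an eigenmeasure of the Fourier transform with eigenvalue `lam`. -/
def IsEigenmeasure (μ : C_c(ℝ, ℂ) → ℂ) (lam : ℂ) : Prop :=
  IsTemperedMeasure μ ∧ μ ≠ 0 ∧ HasFourierTransform μ (lam • μ)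

/-! ### Fourier transform in the strict sense (of measures) -/

/-- The function `f~(x) = conj (f (-x))`. -/
def tilde (f : C_c(ℝ, ℂ)) : C_c(ℝ, ℂ) where
  toFun x := conj (f (-x))
  continuous_toFun := by fun_prop
  hasCompactSupport' :=
    (f.hasCompactSupport.comp_homeomorph (Homeomorph.neg ℝ)).comp_left (g := conj) (map_zero _)

/-- The convolution `(f * h)(x) = ∫ f(t) h(x - t) dt` of two functions in `C_c(ℝ, ℂ)`. -/
def conv (f h : C_c(ℝ, ℂ)) : C_c(ℝ, ℂ) where
  toFun x := ∫ t, f t * h (x - t)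
  continuous_toFun :=
    h.hasCompactSupport.continuous_convolution_right (ContinuousLinearMap.mul ℂ ℂ)
      (f.continuous.locallyIntegrable (μ := volume)) h.continuous
  hasCompactSupport' :=
    HasCompactSupport.convolution (μ := volume) (ContinuousLinearMap.mul ℂ ℂ)
      f.hasCompactSupport h.hasCompactSupport

/-- The Radon measure `μ` is Fourier transformable in the strict sense, with transform the Radon
measure `ν`: for every `f ∈ C_c(ℝ, ℂ)`, with inverse Fourier transform `f^∨`, the function
`|f^∨|²` is integrable with respect to (the total variation of) `ν`, and
`μ(f * f~) = ∫ |f^∨|² dν`. -/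
def HasStrictFourierTransform (μ ν : C_c(ℝ, ℂ) → ℂ) : Prop :=
  IsRadonMeasure μ ∧ IsRadonMeasure ν ∧
    ∃ (m : Measure ℝ) (u : ℝ → ℂ), IsPolarDecomposition ν m u ∧
      ∀ f : C_c(ℝ, ℂ),
        Integrable (fun y => ‖𝓕⁻ (f : ℝ → ℂ) y‖ ^ 2) m ∧
        μ (conv f (tilde f)) = ∫ y, ((‖𝓕⁻ (f : ℝ → ℂ) y‖ ^ 2 : ℝ) : ℂ) * u y ∂m

/-- `μ` is a strict eigenmeasure of the Fourier transform with eigenvalue `lam`. -/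
def IsStrictEigenmeasure (μ : C_c(ℝ, ℂ) → ℂ) (lam : ℂ) : Prop :=
  IsEigenmeasure μ lam ∧ HasStrictFourierTransform μ (lam • μ)

/-! ### Cut and project schemes with physical space `ℝ` and internal space `ℝ` -/

/-- `(ℝ, ℝ, 𝓛)` is a cut and project scheme: `𝓛` is a lattice in `ℝ × ℝ` (a discrete subgroup that
spans), the projection to the first factor (physical space) is injective on `𝓛`, and the
projection of `𝓛` to the second factor (internal space) is dense. -/
structure IsCutAndProjectScheme (𝓛 : Submodule ℤ (ℝ × ℝ)) : Prop where
  discrete : DiscreteTopology 𝓛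
  isZLattice : IsZLattice ℝ 𝓛
  injOn_fst : Set.InjOn Prod.fst (𝓛 : Set (ℝ × ℝ))
  dense_snd : Dense (Prod.snd '' (𝓛 : Set (ℝ × ℝ)))

/-- The dual lattice `𝓛* = {z : z · w ∈ ℤ for all w ∈ 𝓛}`, for the Euclidean inner product. -/
def dualLattice (𝓛 : Submodule ℤ (ℝ × ℝ)) : Set (ℝ × ℝ) :=
  {z | ∀ w ∈ 𝓛, ∃ n : ℤ, z.1 * w.1 + z.2 * w.2 = n}

/-- The projection `L` of the lattice `𝓛` to the physical space. -/
def projL (𝓛 : Submodule ℤ (ℝ × ℝ)) : Set ℝ :=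
  Prod.fst '' (𝓛 : Set (ℝ × ℝ))

/-- The star map: `x ∈ L` is lifted to the point of `𝓛` above it, which is then projected to the
internal space (the value outside `L` is irrelevant). -/
def starMap (𝓛 : Submodule ℤ (ℝ × ℝ)) (x : ℝ) : ℝ :=
  (Function.invFunOn Prod.fst (𝓛 : Set (ℝ × ℝ)) x).2

/-- The weighted Dirac comb `ω_g = ∑_{x ∈ L} g(x^⋆) δ_x`, as a functional on `C_c(ℝ, ℂ)`. -/
def weightedComb (𝓛 : Submodule ℤ (ℝ × ℝ)) (g : 𝓢(ℝ, ℂ)) (φ : C_c(ℝ, ℂ)) : ℂ :=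
  ∑' x : projL 𝓛, g (starMap 𝓛 x) * φ x

end FourierEigenmeasure

end

/-!
For a self-dual lattice `𝓛`, Poisson summation reads
`∑_{(x, y) ∈ 𝓛} φ(x) g(y) = ∑_{(x, y) ∈ 𝓛} φ^∨(x) g^∨(y)`, that is, `𝓕 ω_g = ω_{g^∨}`. If
`𝓕 g = λ g` with `g ≠ 0`, then applying `𝓕` four times gives `λ⁴ = 1`, so `g^∨ = λ̄ g` and
`𝓕 ω_g = λ̄ ω_g`.

The strict version is the same formula for `φ = f * f~`, whose inverse transform `|f^∨|²` need not
decay fast. It is however integrable and band-limited, so it is reproduced by convolution with a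
Schwartz function, and this bounds its sums over the lattice by its integral.

The measure `ω_g` is nonzero because its total variation has mass `|g(y)|` at each `(x, y) ∈ 𝓛`,
and the second coordinates of the lattice points are dense.
-/

namespace FourierEigenmeasure

/-! ### Poisson summation for `ℤᵈ` -/

section Torus

open Set TopologicalSpace UnitAddTorus

variable {d : Type*}

/-- The inclusion `ℤᵈ → ℝᵈ`. -/
def intVec : (d → ℤ) →+ (d → ℝ) := (Int.castAddHom ℝ).compLeft d

@[simp]
theorem intVec_apply (n : d → ℤ) (i : d) : intVec n i = n i := rfl

/-- The quotient map `ℝᵈ → (ℝ/ℤ)ᵈ`. -/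
def torusMk : C(d → ℝ, UnitAddTorus d) := ⟨fun x i => x i, by fun_prop⟩

theorem isQuotientMap_torusMk : Topology.IsQuotientMap (torusMk (d := d)) :=
  (IsOpenQuotientMap.piMap (f := fun (_ : d) (x : ℝ) => (x : UnitAddCircle))
    fun _ => QuotientAddGroup.isOpenQuotientMap_mk).isQuotientMap

theorem torusMk_add_intVec (x : d → ℝ) (n : d → ℤ) : torusMk (x + intVec n) = torusMk x := by
  funext i
  simp [torusMk]

theorem exists_add_intVec_of_torusMk_eq {x y : d → ℝ} (h : torusMk x = torusMk y) :
    ∃ n, x + intVec n = y := by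
  have hcoord (i : d) : ∃ n : ℤ, n • (1 : ℝ) = y i - x i := by
    rw [← AddCircle.coe_eq_zero_iff, AddCircle.coe_sub, sub_eq_zero]
    exact (congrFun h i).symm
  choose n hn using hcoord
  exact ⟨n, funext fun i => by simpa [eq_sub_iff_add_eq'] using hn i⟩

/-- The half-open unit cube with corner `n`. -/
def cube (n : d → ℤ) : Set (d → ℝ) := {x | ∀ i, x i ∈ Ioc (n i : ℝ) (n i + 1)}

theorem mem_cube_iff {n : d → ℤ} {x : d → ℝ} : x ∈ cube n ↔ ∀ i, ⌈x i⌉ = n i + 1 := by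
  simp [cube, Int.ceil_eq_iff]

theorem add_intVec_mem_cube_iff {n : d → ℤ} {x : d → ℝ} :
    x + intVec n ∈ cube n ↔ x ∈ cube (0 : d → ℤ) := by
  simp [mem_cube_iff, add_comm]

theorem pairwise_disjoint_cube : Pairwise (Function.onFun Disjoint (cube (d := d))) := by
  refine fun m n hmn => disjoint_left.2 fun x hm hn => hmn (funext fun i => ?_)
  exact add_right_cancel ((mem_cube_iff.1 hm i).symm.trans (mem_cube_iff.1 hn i))

theorem iUnion_cube : ⋃ n, cube (d := d) n = univ :=
  eq_univ_of_forall fun x => mem_iUnion.2 ⟨fun i => ⌈x i⌉ - 1, by simp [mem_cube_iff]⟩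

theorem cube_zero_subset_Icc : cube (0 : d → ℤ) ⊆ Icc 0 1 :=
  fun x hx => ⟨fun i => by simpa using (hx i).1.le, fun i => by simpa using (hx i).2⟩

theorem measurableSet_cube [Countable d] (n : d → ℤ) : MeasurableSet (cube n) :=
  MeasurableSet.univ_pi' fun _ => measurableSet_Ioc

variable {f : C(d → ℝ, ℂ)}
  (hf : ∀ K : Compacts (d → ℝ),
    Summable fun n : d → ℤ => ‖(f.comp (.addRight (intVec n))).restrict K‖)

include hf in
theorem exists_periodization_on_torus [Finite d] :
    ∃ F : C(UnitAddTorus d, ℂ), ∀ x, F (torusMk x) = ∑' n : d → ℤ, f (x + intVec n) := by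
  let P : C(d → ℝ, ℂ) := ∑' n : d → ℤ, f.comp (.addRight (intVec n))
  have hP (x : d → ℝ) : P x = ∑' n : d → ℤ, f (x + intVec n) :=
    (ContinuousMap.tsum_apply (ContinuousMap.summable_of_locally_summable_norm hf) x).symm
  have hinv (x y : d → ℝ) (h : torusMk x = torusMk y) : P x = P y := by
    obtain ⟨m, rfl⟩ := exists_add_intVec_of_torusMk_eq h
    rw [hP, hP, ← (Equiv.addLeft m).tsum_eq fun n => f (x + intVec n)]
    simp only [Equiv.coe_addLeft, map_add, add_assoc]
  refine ⟨isQuotientMap_torusMk.lift P hinv, fun x => ?_⟩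
  rw [← hP, ← DFunLike.congr_fun (isQuotientMap_torusMk.lift_comp P hinv) x]
  rfl

variable [Fintype d]

theorem hasSum_integral_cube {F : (d → ℝ) → ℂ} (hF : Integrable F) :
    HasSum (fun n : d → ℤ => ∫ x in cube (0 : d → ℤ), F (x + intVec n)) (∫ x, F x) := by
  have htranslate (n : d → ℤ) :
      ∫ x in cube n, F x = ∫ x in cube (0 : d → ℤ), F (x + intVec n) := by
    rw [← (measurePreserving_add_right volume (intVec n)).setIntegral_preimage_emb
      (measurableEmbedding_addRight _) F (cube n)]
    congr 2
    exact ext fun x => add_intVec_mem_cube_iff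
  have hsum := hasSum_integral_iUnion (f := F) (μ := volume) (measurableSet_cube (d := d))
    pairwise_disjoint_cube (by rw [iUnion_cube]; exact hF.integrableOn)
  simpa only [iUnion_cube, setIntegral_univ, htranslate] using hsum

theorem mFourier_torusMk (k : d → ℤ) (x : d → ℝ) :
    mFourier k (torusMk x) = (𝐞 (intVec k ⬝ᵥ x) : ℂ) := by
  simp only [mFourier, torusMk, ContinuousMap.coe_mk, fourier_coe_apply, Real.fourierChar_apply,
    ← Complex.exp_sum, dotProduct, intVec_apply]
  congr 1
  push_cast [Finset.mul_sum, Finset.sum_mul]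
  exact Finset.sum_congr rfl fun i _ => by ring

include hf

theorem integrable_of_summable_norm_restrict_intVec : Integrable f := by
  refine integrable_of_summable_norm_restrict
    (s := fun n : d → ℤ => ⟨Icc (intVec n) (intVec n + 1), isCompact_Icc⟩) ?_ ?_
  · refine (hf ⟨Icc 0 1, isCompact_Icc⟩).of_nonneg_of_le (fun n => by positivity) fun n => ?_
    have hvol : volume.real (Icc (intVec n) (intVec n + 1) : Set (d → ℝ)) = 1 := by
      simp [Measure.real, Real.volume_Icc_pi]
    refine (congrArg _ hvol).trans_le ((mul_one _).trans_le
      ((ContinuousMap.norm_le _ (norm_nonneg _)).2 ?_))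
    rintro ⟨x, hx⟩
    have hx' : x - intVec n ∈ Icc (0 : d → ℝ) 1 := by
      rwa [mem_Icc, sub_nonneg, sub_le_iff_le_add']
    simpa using ContinuousMap.norm_coe_le_norm
      ((f.comp (.addRight (intVec n))).restrict (Icc 0 1)) ⟨_, hx'⟩
  · refine eq_univ_of_univ_subset (iUnion_cube.symm.subset.trans (iUnion_mono fun n x hx => ?_))
    exact ⟨fun i => (hx i).1.le, fun i => (hx i).2⟩

theorem setIntegral_cube_tsum :
    ∫ x in cube (0 : d → ℤ), ∑' n : d → ℤ, f (x + intVec n) = ∫ x, f x := by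
  have hint : Integrable f := integrable_of_summable_norm_restrict_intVec hf
  have hfin : volume (cube (0 : d → ℤ)) < ⊤ :=
    (measure_mono cube_zero_subset_Icc).trans_lt isCompact_Icc.measure_lt_top
  rw [← (hasSum_integral_cube hint).tsum_eq]
  refine (integral_tsum_of_summable_integral_norm
    (fun n => (hint.comp_add_right (intVec n)).integrableOn) ?_).symm
  refine ((hf ⟨Icc 0 1, isCompact_Icc⟩).mul_right (volume.real (cube (0 : d → ℤ)))).of_nonneg_of_le
    (fun n => by positivity) fun n => (Real.le_norm_self _).trans ?_
  refine norm_setIntegral_le_of_norm_le_const hfin fun x hx => ?_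
  rw [norm_norm]
  exact ContinuousMap.norm_coe_le_norm
    ((f.comp (.addRight (intVec n))).restrict (Icc 0 1)) ⟨x, cube_zero_subset_Icc hx⟩

theorem mFourierCoeff_periodization {F : UnitAddTorus d → ℂ}
    (hF : ∀ x, F (torusMk x) = ∑' n : d → ℤ, f (x + intVec n)) (k : d → ℤ) :
    mFourierCoeff F k = ∫ x, 𝐞 (-(intVec k ⬝ᵥ x)) • f x := by
  let e : C(d → ℝ, ℂ) := (mFourier (-k)).comp torusMk
  have he (x : d → ℝ) : e x = (𝐞 (-(intVec k ⬝ᵥ x)) : ℂ) := by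
    simp only [e, ContinuousMap.comp_apply, mFourier_torusMk, map_neg, neg_dotProduct]
  have hper (x : d → ℝ) (n : d → ℤ) : e (x + intVec n) = e x := by
    simp only [e, ContinuousMap.comp_apply, torusMk_add_intVec]
  have hef (K : Compacts (d → ℝ)) :
      Summable fun n : d → ℤ => ‖((e * f).comp (.addRight (intVec n))).restrict K‖ := by
    refine (hf K).of_nonneg_of_le (fun n => norm_nonneg _) fun n => ?_
    refine (ContinuousMap.norm_le _ (norm_nonneg _)).2 fun x => ?_
    refine Eq.trans_le ?_ (ContinuousMap.norm_coe_le_norm _ x)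
    change ‖e _ * f _‖ = ‖f _‖
    rw [norm_mul, he, Circle.norm_coe, one_mul]
  calc mFourierCoeff F k
      = ∫ x in cube (0 : d → ℤ), e x * ∑' n : d → ℤ, f (x + intVec n) := by
        simp only [mFourierCoeff_eq_integral F k 0, ← hF, cube, Pi.zero_apply, Int.cast_zero]
        rfl
    _ = ∫ x in cube (0 : d → ℤ), ∑' n : d → ℤ, (e * f) (x + intVec n) := by
        simp only [ContinuousMap.mul_apply, hper, tsum_mul_left]
    _ = ∫ x, 𝐞 (-(intVec k ⬝ᵥ x)) • f x := by
        simp only [setIntegral_cube_tsum hef, Circle.smul_def, smul_eq_mul, ← he]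
        rfl

theorem tsum_intVec_eq_tsum_integral
    (hsum : Summable fun k : d → ℤ => ∫ x, 𝐞 (-(intVec k ⬝ᵥ x)) • f x) :
    ∑' n : d → ℤ, f (intVec n) = ∑' k : d → ℤ, ∫ x, 𝐞 (-(intVec k ⬝ᵥ x)) • f x := by
  obtain ⟨F, hF⟩ := exists_periodization_on_torus hf
  have hcoeff := mFourierCoeff_periodization hf hF
  have hseries := (hasSum_mFourier_series_apply_of_summable
    (show Summable (mFourierCoeff F) by simpa only [funext hcoeff] using hsum) (torusMk 0)).tsum_eq
  simpa [hF, hcoeff, mFourier_torusMk] using hseries.symm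

end Torus

/-! ### Poisson summation for a lattice in a finite-dimensional space -/

section Lattice

open Module TopologicalSpace ZLattice

variable {d E : Type*} [NormedAddCommGroup E] [NormedSpace ℝ E]
  {L : Submodule ℤ E} [DiscreteTopology L] [IsZLattice ℝ L] (b : Basis d ℤ L)

theorem equivFun_symm_intVec [Finite d] [FiniteDimensional ℝ E] (n : d → ℤ) :
    (b.ofZLatticeBasis ℝ L).equivFun.symm (intVec n) = b.equivFun.symm n := by
  have := Fintype.ofFinite d
  simp [Basis.equivFun_symm_apply, Int.cast_smul_eq_zsmul]

theorem summable_norm_restrict_comp_equivFunL_symm [Finite d] [FiniteDimensional ℝ E] {f : C(E, ℂ)}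
    (hf : ∀ K : Compacts E, Summable fun z : L => ‖(f.comp (.addRight (z : E))).restrict K‖)
    (K : Compacts (d → ℝ)) :
    Summable fun n : d → ℤ => ‖((f.comp ((b.ofZLatticeBasis ℝ L).equivFunL.symm : C(d → ℝ, E))).comp
      (.addRight (intVec n))).restrict K‖ := by
  let T := (b.ofZLatticeBasis ℝ L).equivFunL.symm
  refine .of_nonneg_of_le (fun _ => norm_nonneg _) (fun n => ?_)
    (b.equivFun.symm.toEquiv.summable_iff.2 (hf (K.map T T.continuous)))
  refine (ContinuousMap.norm_le _ (norm_nonneg _)).2 fun x => ?_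
  have hx : T (x + intVec n) = T x + b.equivFun.symm n :=
    (map_add T _ _).trans (congrArg _ (equivFun_symm_intVec b n))
  change ‖f (T (x + intVec n))‖ ≤ _
  rw [hx]
  exact ((f.comp (.addRight (b.equivFun.symm n : E))).restrict (K.map T T.continuous)
    ).norm_coe_le_norm ⟨T x, Set.mem_image_of_mem T x.2⟩

variable [Fintype d]

theorem exists_equiv_dualSubmodule [FiniteDimensional ℝ E] {B : LinearMap.BilinForm ℝ E}
    (hB : B.Nondegenerate) : ∃ e : (d → ℤ) ≃ B.dualSubmodule L, ∀ k x,
      B (e k) ((b.ofZLatticeBasis ℝ L).equivFun.symm x) = intVec k ⬝ᵥ x := by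
  classical
  let bE := b.ofZLatticeBasis ℝ L
  have hdual : Submodule.span ℤ (Set.range (B.dualBasis hB bE)) = B.dualSubmodule L := by
    rw [← B.dualSubmodule_span_of_basis hB, b.ofZLatticeBasis_span ℝ]
  refine ⟨(((B.dualBasis hB bE).restrictScalars ℤ).equivFun.symm ≪≫ₗ
    LinearEquiv.ofEq _ _ hdual).toEquiv, fun k x => ?_⟩
  have hpair (i : d) : B (((B.dualBasis hB bE).restrictScalars ℤ).equivFun.symm k : E) (bE i) =
      k i := by
    simp [B.apply_dualBasis_left]
  change B (((B.dualBasis hB bE).restrictScalars ℤ).equivFun.symm k : E) (bE.equivFun.symm x) = _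
  simp only [bE.equivFun_symm_apply, map_sum, map_smul, hpair, dotProduct, smul_eq_mul,
    intVec_apply, mul_comm]

variable [FiniteDimensional ℝ E] [MeasurableSpace E] [BorelSpace E]
  (μ : Measure E) [μ.IsAddHaarMeasure]

theorem integral_comp_equivFun_symm (f : E → ℂ) :
    ∫ x, f ((b.ofZLatticeBasis ℝ L).equivFun.symm x) = (covolume L μ)⁻¹ • ∫ y, f y ∂μ := by
  let T : (d → ℝ) ≃L[ℝ] E := (b.ofZLatticeBasis ℝ L).equivFunL.symm
  let ν : Measure E := volume.map T
  have hν : ν.IsAddHaarMeasure := T.isAddHaarMeasure_map volume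
  have hcube : T ⁻¹' ZSpan.fundamentalDomain (b.ofZLatticeBasis ℝ L) =
      Set.univ.pi fun _ => Set.Ico (0 : ℝ) 1 := by
    ext x
    have hx : (b.ofZLatticeBasis ℝ L).repr (T x) = x :=
      (b.ofZLatticeBasis ℝ L).equivFun.apply_symm_apply x
    simp [ZSpan.mem_fundamentalDomain, hx]
  have hunit : ν (ZSpan.fundamentalDomain (b.ofZLatticeBasis ℝ L)) = 1 := by
    rw [Measure.map_apply T.continuous.measurable (ZSpan.fundamentalDomain_measurableSet _), hcube]
    simp [volume_pi]
  have hμ : μ = μ.addHaarScalarFactor ν • ν := Measure.isAddLeftInvariant_eq_smul μ ν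
  have hcovol : covolume L μ = μ.addHaarScalarFactor ν := by
    rw [covolume_eq_measure_fundamentalDomain L μ (isAddFundamentalDomain b μ), Measure.real]
    nth_rewrite 1 [hμ]
    simp [hunit]
  have hint : ∫ x, f (T x) = ∫ y, f y ∂ν :=
    (T.toHomeomorph.measurableEmbedding.integral_map f).symm
  rw [eq_inv_smul_iff₀ (covolume_ne_zero L μ)]
  nth_rewrite 2 [hμ]
  rw [integral_smul_nnreal_measure, hcovol, ← hint]
  rfl

variable {B : LinearMap.BilinForm ℝ E} (hB : B.Nondegenerate) {f : C(E, ℂ)}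

include hB

theorem tsum_lattice_eq_tsum_dualSubmodule
    (hf : ∀ K : Compacts E, Summable fun z : L => ‖(f.comp (.addRight (z : E))).restrict K‖)
    (hsum : Summable fun w : B.dualSubmodule L => ∫ y, 𝐞 (-B w y) • f y ∂μ) :
    ∑' z : L, f z = (covolume L μ)⁻¹ • ∑' w : B.dualSubmodule L, ∫ y, 𝐞 (-B w y) • f y ∂μ := by
  have := ZLattice.module_finite ℝ L
  have := ZLattice.module_free ℝ L
  let b := Free.chooseBasis ℤ L
  let T := (b.ofZLatticeBasis ℝ L).equivFunL.symm
  obtain ⟨e, he⟩ := exists_equiv_dualSubmodule b hB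
  let F : C(Free.ChooseBasisIndex ℤ L → ℝ, ℂ) := f.comp T
  have hT (n : Free.ChooseBasisIndex ℤ L → ℤ) : T (intVec n) = b.equivFun.symm n :=
    equivFun_symm_intVec b n
  have hF (K : Compacts (Free.ChooseBasisIndex ℤ L → ℝ)) :
      Summable fun n => ‖(F.comp (.addRight (intVec n))).restrict K‖ :=
    summable_norm_restrict_comp_equivFunL_symm b hf K
  have hfour (k : Free.ChooseBasisIndex ℤ L → ℤ) : ∫ x, 𝐞 (-(intVec k ⬝ᵥ x)) • F x =
      (covolume L μ)⁻¹ • ∫ y, 𝐞 (-B (e k) y) • f y ∂μ := by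
    simp only [← integral_comp_equivFun_symm b μ, he]
    rfl
  have hsum' : Summable fun k => ∫ x, 𝐞 (-(intVec k ⬝ᵥ x)) • F x := by
    simp only [hfour]
    exact (e.summable_iff.2 hsum).const_smul _
  calc
    ∑' z : L, f z = ∑' n, F (intVec n) := by
      rw [← b.equivFun.symm.toEquiv.tsum_eq]
      exact tsum_congr fun n => congrArg f (hT n).symm
    _ = ∑' k, (covolume L μ)⁻¹ • ∫ y, 𝐞 (-B (e k) y) • f y ∂μ := by
      simp only [tsum_intVec_eq_tsum_integral hF hsum', hfour]
    _ = (covolume L μ)⁻¹ • ∑' w : B.dualSubmodule L, ∫ y, 𝐞 (-B w y) • f y ∂μ := by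
      rw [tsum_const_smul'', e.tsum_eq fun w : B.dualSubmodule L => ∫ y, 𝐞 (-B w y) • f y ∂μ]

end Lattice

/-! ### Polynomial decay and sums over a lattice -/

section Decay

variable {E F : Type*} [NormedAddCommGroup E] [NormedAddCommGroup F] {r : ℕ}

/-- The comparison function `(1 + ‖x‖)⁻ʳ` for polynomial decay of order `r`. -/
noncomputable def decayWeight (r : ℕ) (x : E) : ℝ := ((1 + ‖x‖) ^ r)⁻¹

theorem decayWeight_pos (x : E) : 0 < decayWeight r x := by
  unfold decayWeight
  positivity

theorem decayWeight_add_le (x : E) {y : E} {S : ℝ} (hy : ‖y‖ ≤ S) :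
    decayWeight r (x + y) ≤ (1 + S) ^ r * decayWeight r x := by
  have hS : 0 ≤ S := (norm_nonneg y).trans hy
  have hx : 1 + ‖x‖ ≤ (1 + S) * (1 + ‖x + y‖) := by
    have : ‖x‖ ≤ ‖x + y‖ + ‖y‖ := by simpa using norm_sub_le (x + y) y
    nlinarith [norm_nonneg (x + y)]
  rw [decayWeight, decayWeight, ← div_eq_mul_inv, inv_le_comm₀ (by positivity) (by positivity),
    inv_div, div_le_iff₀ (by positivity), ← mul_pow, mul_comm (1 + ‖x + y‖)]
  gcongr

theorem decayWeight_fst_mul_snd_le (z : E × F) :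
    decayWeight r z.1 * decayWeight r z.2 ≤ decayWeight r z := by
  have hz : ‖z‖ ≤ ‖z.1‖ + ‖z.2‖ := max_le_add_of_nonneg (norm_nonneg _) (norm_nonneg _)
  rw [decayWeight, decayWeight, decayWeight, ← mul_inv, ← mul_pow]
  gcongr
  nlinarith [mul_nonneg (norm_nonneg z.1) (norm_nonneg z.2)]

/-- Polynomial decay of order `r`. -/
def HasDecay (r : ℕ) (f : E → F) : Prop := ∃ C : ℝ, ∀ x, ‖f x‖ ≤ C * decayWeight r x

theorem HasDecay.exists_nonneg {f : E → F} (hf : HasDecay r f) :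
    ∃ C : ℝ, 0 ≤ C ∧ ∀ x, ‖f x‖ ≤ C * decayWeight r x := by
  obtain ⟨C, hC⟩ := hf
  refine ⟨C, ?_, hC⟩
  simpa [decayWeight] using (norm_nonneg _).trans (hC 0)

theorem HasDecay.fst_mul_snd {G R : Type*} [NormedAddCommGroup G] [NormedRing R] {φ : E → R}
    {ψ : G → R} (hφ : HasDecay r φ) (hψ : HasDecay r ψ) :
    HasDecay r fun z : E × G => φ z.1 * ψ z.2 := by
  obtain ⟨C, hC0, hC⟩ := hφ.exists_nonneg
  obtain ⟨D, hD0, hD⟩ := hψ.exists_nonneg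
  refine ⟨C * D, fun z => ?_⟩
  calc
    ‖φ z.1 * ψ z.2‖ ≤ ‖φ z.1‖ * ‖ψ z.2‖ := norm_mul_le _ _
    _ ≤ C * decayWeight r z.1 * (D * decayWeight r z.2) :=
      mul_le_mul (hC _) (hD _) (norm_nonneg _) (mul_nonneg hC0 (decayWeight_pos _).le)
    _ = C * D * (decayWeight r z.1 * decayWeight r z.2) := by ring
    _ ≤ C * D * decayWeight r z := by
      gcongr
      exact decayWeight_fst_mul_snd_le z

theorem HasDecay.of_bounded_of_isBounded {f : E → F} {s : Set E} {M : ℝ}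
    (hs : Bornology.IsBounded s) (hM : ∀ x ∈ s, ‖f x‖ ≤ M) (hf : ∀ x ∉ s, f x = 0) :
    HasDecay r f := by
  obtain ⟨S, hS⟩ := hs.exists_norm_le
  refine ⟨|M| * (1 + |S|) ^ r, fun x => ?_⟩
  by_cases hx : x ∈ s
  · have hxS : ‖x‖ ≤ |S| := (hS x hx).trans (le_abs_self S)
    rw [decayWeight, ← div_eq_mul_inv, le_div_iff₀ (by positivity)]
    gcongr
    exact (hM x hx).trans (le_abs_self M)
  · rw [hf x hx, norm_zero]
    have := decayWeight_pos (r := r) x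
    positivity

theorem hasDecay_compactlySupported (f : C_c(E, F)) : HasDecay r f := by
  obtain ⟨M, hM⟩ := f.hasCompactSupport.exists_bound_of_continuous f.continuous
  exact .of_bounded_of_isBounded f.hasCompactSupport.isCompact.isBounded (fun x _ => hM x)
    fun x hx => image_eq_zero_of_notMem_tsupport hx

variable [NormedSpace ℝ E]

theorem hasDecay_schwartzMap [NormedSpace ℝ F] (f : 𝓢(E, F)) : HasDecay r f := by
  refine ⟨2 ^ r * (Finset.Iic (r, 0)).sup (schwartzSeminormFamily ℝ E F) f, fun x => ?_⟩
  have h := SchwartzMap.one_add_le_sup_seminorm_apply (𝕜 := ℝ) (m := (r, 0)) le_rfl le_rfl f x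
  rw [norm_iteratedFDeriv_zero] at h
  rwa [decayWeight, ← div_eq_mul_inv, le_div_iff₀ (by positivity), mul_comm]

variable [FiniteDimensional ℝ E] (L : Submodule ℤ E) [DiscreteTopology L]

theorem summable_decayWeight (hr : Module.finrank ℤ L < r) :
    Summable fun z : L => decayWeight r (z : E) := by
  refine .of_norm_bounded_eventually (ZLattice.summable_norm_pow_inv L r hr)
    ((Set.finite_singleton (0 : L)).subset fun z hz => ?_)
  by_contra h0
  refine hz ?_
  have hz0 : 0 < ‖z‖ := norm_pos_iff.2 h0
  change ‖decayWeight r (z : E)‖ ≤ ‖z‖⁻¹ ^ r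
  rw [Real.norm_of_nonneg (decayWeight_pos _).le, decayWeight, inv_pow]
  exact inv_anti₀ (pow_pos hz0 r)
    (pow_le_pow_left₀ hz0.le (le_add_of_nonneg_left zero_le_one) r)

variable {L}

theorem HasDecay.summable [CompleteSpace F] {f : E → F} (hf : HasDecay r f)
    (hr : Module.finrank ℤ L < r) : Summable fun z : L => f z := by
  obtain ⟨C, hC⟩ := hf
  exact .of_norm_bounded ((summable_decayWeight L hr).mul_left C) fun z => hC z

theorem HasDecay.summable_norm_restrict {f : C(E, F)} (hf : HasDecay r f)
    (hr : Module.finrank ℤ L < r) (K : TopologicalSpace.Compacts E) :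
    Summable fun z : L => ‖(f.comp (.addRight (z : E))).restrict K‖ := by
  obtain ⟨C, hC0, hC⟩ := hf.exists_nonneg
  obtain ⟨S, hS0, hS⟩ := K.isCompact.isBounded.exists_pos_norm_le
  refine .of_nonneg_of_le (fun _ => norm_nonneg _) (fun z => ?_)
    ((summable_decayWeight L hr).mul_left (C * (1 + S) ^ r))
  have hw := decayWeight_pos (r := r) (z : E)
  refine (ContinuousMap.norm_le _ (by positivity)).2 fun x => ?_
  calc
    ‖f (x + z)‖ ≤ C * decayWeight r (z + x : E) := by simpa only [add_comm] using hC (x + z)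
    _ ≤ C * ((1 + S) ^ r * decayWeight r (z : E)) := by
      gcongr
      exact decayWeight_add_le _ (hS x x.2)
    _ = C * (1 + S) ^ r * decayWeight r (z : E) := by ring

variable [IsZLattice ℝ L]

variable (L) in
theorem exists_norm_sub_lattice_le : ∃ S : ℝ, ∀ y : E, ∃ n : L, ‖(n : E) - y‖ ≤ S := by
  have := ZLattice.module_finite ℝ L
  have := ZLattice.module_free ℝ L
  let b := Module.Free.chooseBasis ℤ L
  refine ⟨∑ i, ‖b.ofZLatticeBasis ℝ L i‖, fun y => ?_⟩
  have hfloor : (ZSpan.floor (b.ofZLatticeBasis ℝ L) y : E) ∈ L := by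
    simpa only [b.ofZLatticeBasis_span ℝ] using (ZSpan.floor (b.ofZLatticeBasis ℝ L) y).2
  refine ⟨⟨_, hfloor⟩, ?_⟩
  rw [norm_sub_rev]
  exact ZSpan.norm_fract_le _ y

variable (L) in
theorem exists_sum_decayWeight_sub_le (hr : Module.finrank ℤ L < r) :
    ∃ C : ℝ, ∀ (y : E) (s : Finset L), ∑ z ∈ s, decayWeight r (z - y : E) ≤ C := by
  obtain ⟨S, hS⟩ := exists_norm_sub_lattice_le L
  refine ⟨(1 + S) ^ r * ∑' z : L, decayWeight r (z : E), fun y s => ?_⟩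
  obtain ⟨n, hn⟩ := hS y
  have hS0 : 0 ≤ S := (norm_nonneg _).trans hn
  have hshift : Summable fun z : L => decayWeight r ((z - n : L) : E) :=
    (Equiv.subRight n).summable_iff.2 (summable_decayWeight L hr)
  calc
    ∑ z ∈ s, decayWeight r (z - y : E) ≤ ∑ z ∈ s, (1 + S) ^ r * decayWeight r ((z - n : L) : E) :=
      Finset.sum_le_sum fun z _ => by simpa using decayWeight_add_le (z - n : E) hn
    _ = (1 + S) ^ r * ∑ z ∈ s, decayWeight r ((z - n : L) : E) := (Finset.mul_sum _ _ _).symm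
    _ ≤ (1 + S) ^ r * ∑' z : L, decayWeight r ((z - n : L) : E) := by
      gcongr
      exact hshift.sum_le_tsum s fun z _ => (decayWeight_pos _).le
    _ = (1 + S) ^ r * ∑' z : L, decayWeight r (z : E) := by
      rw [← (Equiv.subRight n).tsum_eq fun z : L => decayWeight r (z : E)]
      rfl

theorem HasDecay.exists_sum_norm_sub_le {f : E → F} (hf : HasDecay r f)
    (hr : Module.finrank ℤ L < r) :
    ∃ C : ℝ, ∀ (y : E) (s : Finset L), ∑ z ∈ s, ‖f (z - y)‖ ≤ C := by
  obtain ⟨C, hC0, hC⟩ := hf.exists_nonneg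
  obtain ⟨D, hD⟩ := exists_sum_decayWeight_sub_le L hr
  refine ⟨C * D, fun y s => ?_⟩
  calc ∑ z ∈ s, ‖f (z - y)‖ ≤ ∑ z ∈ s, C * decayWeight r (z - y : E) :=
        Finset.sum_le_sum fun z _ => hC _
    _ ≤ C * D := by
        rw [← Finset.mul_sum]
        exact mul_le_mul_of_nonneg_left (hD y s) hC0

end Decay

/-! ### Poisson summation for a self-dual lattice in a product -/

section Product

open Module Real ZLattice RealInnerProductSpace

variable {V W : Type*} [NormedAddCommGroup V] [InnerProductSpace ℝ V] [NormedAddCommGroup W]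
  [InnerProductSpace ℝ W]

variable (V W) in
/-- The Euclidean inner product on `V × W`, as a bilinear form (the norm of `V × W` is not
Euclidean). -/
noncomputable def prodInner : LinearMap.BilinForm ℝ (V × W) :=
  (innerₗ V).compl₁₂ (.fst ℝ V W) (.fst ℝ V W) + (innerₗ W).compl₁₂ (.snd ℝ V W) (.snd ℝ V W)

theorem prodInner_apply (z w : V × W) : prodInner V W z w = ⟪z.1, w.1⟫ + ⟪z.2, w.2⟫ := rfl

theorem nondegenerate_prodInner : (prodInner V W).Nondegenerate := by
  have hself (z : V × W) (hz : prodInner V W z z = 0) : z = 0 := by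
    obtain ⟨h1, h2⟩ :=
      (add_eq_zero_iff_of_nonneg real_inner_self_nonneg real_inner_self_nonneg).1 hz
    exact Prod.ext (inner_self_eq_zero.1 h1) (inner_self_eq_zero.1 h2)
  exact ⟨fun z hz => hself z (hz z), fun z hz => hself z (hz z)⟩

variable [FiniteDimensional ℝ V]

theorem exists_schwartzMap_eq_one_of_norm_le (R : ℝ) :
    ∃ β : 𝓢(V, ℂ), (∀ x, ‖x‖ ≤ R → β x = 1) ∧ ∃ ρ : V → ℝ, (∀ x, 0 ≤ ρ x) ∧ ∀ x, β x = ρ x := by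
  let ρ : ContDiffBump (0 : V) := ⟨max R 1, max R 1 + 1, by positivity, lt_add_one _⟩
  have hsupp : HasCompactSupport fun x => (ρ x : ℂ) :=
    ρ.hasCompactSupport.comp_left Complex.ofReal_zero
  refine ⟨hsupp.toSchwartzMap (Complex.ofRealCLM.contDiff.comp ρ.contDiff), fun x hx => ?_,
    ρ, fun x => ρ.nonneg, fun x => rfl⟩
  have hρ : ρ x = 1 :=
    ρ.one_of_mem_closedBall (mem_closedBall_zero_iff.2 (hx.trans (le_max_left R 1)))
  change (ρ x : ℂ) = 1
  rw [hρ, Complex.ofReal_one]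

variable [FiniteDimensional ℝ W] {L : Submodule ℤ (V × W)} [DiscreteTopology L]

theorem summable_schwartzMap_mul (f : 𝓢(V, ℂ)) (g : 𝓢(W, ℂ)) :
    Summable fun z : L => f (z : V × W).1 * g (z : V × W).2 :=
  ((hasDecay_schwartzMap f).fst_mul_snd (hasDecay_schwartzMap g)).summable (Nat.lt_succ_self _)

variable (L) in
theorem exists_tsum_schwartzMap_mul_ne_zero :
    ∃ (f : 𝓢(V, ℂ)) (g : 𝓢(W, ℂ)), ∑' z : L, f (z : V × W).1 * g (z : V × W).2 ≠ 0 := by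
  obtain ⟨f, hf1, ρ, hρ, hf⟩ := exists_schwartzMap_eq_one_of_norm_le (V := V) 0
  obtain ⟨g, hg1, σ, hσ, hg⟩ := exists_schwartzMap_eq_one_of_norm_le (V := W) 0
  refine ⟨f, g, ?_⟩
  have hsum := summable_schwartzMap_mul (L := L) f g
  simp only [hf, hg, ← Complex.ofReal_mul, Complex.summable_ofReal] at hsum hf1 hg1 ⊢
  have hρ0 : ρ 0 = 1 := mod_cast hf1 0 norm_zero.le
  have hσ0 : σ 0 = 1 := mod_cast hg1 0 norm_zero.le
  rw [← Complex.ofReal_tsum, Complex.ofReal_ne_zero]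
  exact (hsum.tsum_pos (fun z => mul_nonneg (hρ _) (hσ _)) 0 (by simp [hρ0, hσ0])).ne'

variable [MeasurableSpace V] [BorelSpace V] [MeasurableSpace W] [BorelSpace W]

instance isAddHaarMeasure_volume_prod : (volume : Measure (V × W)).IsAddHaarMeasure :=
  Measure.prod.instIsAddHaarMeasure _ _

theorem integral_prodInner_mul (φ : V → ℂ) (ψ : W → ℂ) (w : V × W) :
    ∫ y : V × W, 𝐞 (-prodInner V W w y) • (φ y.1 * ψ y.2) = 𝓕 φ w.1 * 𝓕 ψ w.2 := by
  rw [fourier_eq, fourier_eq, ← integral_prod_mul]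
  refine integral_congr_ae (.of_forall fun y => ?_)
  simp only [prodInner_apply, neg_add, AddChar.map_add_eq_mul, real_inner_comm, Circle.smul_def,
    Circle.coe_mul, smul_eq_mul]
  ring

variable [IsZLattice ℝ L] {φ : V → ℂ} {ψ : W → ℂ} {r : ℕ}

theorem tsum_mul_eq_tsum_fourier_mul (hr : finrank ℝ (V × W) < r) (hφ : HasDecay r φ)
    (hψ : HasDecay r ψ) (hφc : Continuous φ) (hψc : Continuous ψ)
    (hsum : Summable fun w : (prodInner V W).dualSubmodule L =>
      𝓕 φ (w : V × W).1 * 𝓕 ψ (w : V × W).2) :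
    ∑' z : L, φ (z : V × W).1 * ψ (z : V × W).2 = (covolume L)⁻¹ •
      ∑' w : (prodInner V W).dualSubmodule L, 𝓕 φ (w : V × W).1 * 𝓕 ψ (w : V × W).2 := by
  let f : C(V × W, ℂ) := ⟨fun z => φ z.1 * ψ z.2, by fun_prop⟩
  have hf (w : V × W) : ∫ y, 𝐞 (-prodInner V W w y) • f y = 𝓕 φ w.1 * 𝓕 ψ w.2 :=
    integral_prodInner_mul φ ψ w
  have hfdecay : HasDecay r f := hφ.fst_mul_snd hψ
  simp only [← hf] at hsum ⊢
  exact tsum_lattice_eq_tsum_dualSubmodule volume nondegenerate_prodInner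
    (hfdecay.summable_norm_restrict (by rwa [ZLattice.rank ℝ L])) hsum

section SelfDual

variable (hdual : (prodInner V W).dualSubmodule L = L)

include hdual

theorem tsum_mul_eq_tsum_fourierInv_mul_of_covolume (hr : finrank ℝ (V × W) < r)
    (hφ : HasDecay r φ) (hψ : HasDecay r ψ) (hφc : Continuous φ) (hψc : Continuous ψ)
    (hsum : Summable fun z : L => 𝓕⁻ φ (z : V × W).1 * 𝓕⁻ ψ (z : V × W).2) :
    ∑' z : L, φ (z : V × W).1 * ψ (z : V × W).2 =
      (covolume L)⁻¹ • ∑' z : L, 𝓕⁻ φ (z : V × W).1 * 𝓕⁻ ψ (z : V × W).2 := by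
  have hneg (z : L) : 𝓕 φ ((-z : L) : V × W).1 * 𝓕 ψ ((-z : L) : V × W).2 =
      𝓕⁻ φ (z : V × W).1 * 𝓕⁻ ψ (z : V × W).2 := by
    simp [fourierInv_eq_fourier_neg]
  have hsum' : Summable fun z : L => 𝓕 φ (z : V × W).1 * 𝓕 ψ (z : V × W).2 := by
    rw [← (Equiv.neg L).summable_iff]
    simpa only [Function.comp_def, Equiv.neg_apply, hneg] using hsum
  rw [tsum_mul_eq_tsum_fourier_mul hr hφ hψ hφc hψc (by rwa [hdual]), hdual,
    ← (Equiv.neg L).tsum_eq]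
  simp only [Equiv.neg_apply, hneg]

theorem tsum_schwartzMap_mul_of_covolume (f : 𝓢(V, ℂ)) (g : 𝓢(W, ℂ)) :
    ∑' z : L, f (z : V × W).1 * g (z : V × W).2 =
      (covolume L)⁻¹ • ∑' z : L, 𝓕⁻ f (z : V × W).1 * 𝓕⁻ g (z : V × W).2 := by
  have hsum := summable_schwartzMap_mul (L := L) (𝓕⁻ f) (𝓕⁻ g)
  rw [SchwartzMap.fourierInv_coe, SchwartzMap.fourierInv_coe] at hsum ⊢
  exact tsum_mul_eq_tsum_fourierInv_mul_of_covolume hdual (Nat.lt_succ_self _)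
    (hasDecay_schwartzMap f) (hasDecay_schwartzMap g) f.continuous g.continuous hsum

-- Applying Poisson summation twice multiplies the nonzero sum `S f g` by `(covolume L)⁻²`.
theorem covolume_eq_one_of_selfDual : covolume L = 1 := by
  let S (f : 𝓢(V, ℂ)) (g : 𝓢(W, ℂ)) : ℂ := ∑' z : L, f (z : V × W).1 * g (z : V × W).2
  have hpoisson (f : 𝓢(V, ℂ)) (g : 𝓢(W, ℂ)) : S f g = (covolume L)⁻¹ • S (𝓕⁻ f) (𝓕⁻ g) :=
    tsum_schwartzMap_mul_of_covolume hdual f g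
  have hneg (f : 𝓢(V, ℂ)) (g : 𝓢(W, ℂ)) : S (𝓕⁻ f) (𝓕⁻ g) = S (𝓕 f) (𝓕 g) :=
    (Equiv.neg L).tsum_eq fun z : L => 𝓕 f (z : V × W).1 * 𝓕 g (z : V × W).2
  obtain ⟨f, g, hfg⟩ := exists_tsum_schwartzMap_mul_ne_zero L
  have hsq : (1 : ℝ) • S f g = (covolume L)⁻¹ ^ 2 • S f g := by
    have := hpoisson (𝓕 f) (𝓕 g)
    rw [FourierTransform.fourierInv_fourier_eq, FourierTransform.fourierInv_fourier_eq] at this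
    rw [one_smul, sq, mul_smul, ← this, ← hneg, ← hpoisson]
  exact inv_eq_one.1 ((pow_eq_one_iff_of_nonneg (inv_nonneg.2 (covolume_pos L volume).le)
    two_ne_zero).1 (smul_left_injective ℝ hfg hsq).symm)

theorem tsum_mul_eq_tsum_fourierInv_mul (hr : finrank ℝ (V × W) < r)
    (hφ : HasDecay r φ) (hψ : HasDecay r ψ) (hφc : Continuous φ) (hψc : Continuous ψ)
    (hsum : Summable fun z : L => 𝓕⁻ φ (z : V × W).1 * 𝓕⁻ ψ (z : V × W).2) :
    ∑' z : L, φ (z : V × W).1 * ψ (z : V × W).2 =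
      ∑' z : L, 𝓕⁻ φ (z : V × W).1 * 𝓕⁻ ψ (z : V × W).2 := by
  rw [tsum_mul_eq_tsum_fourierInv_mul_of_covolume hdual hr hφ hψ hφc hψc hsum,
    covolume_eq_one_of_selfDual hdual, inv_one, one_smul]

end SelfDual

end Product

/-! ### Summability of band-limited functions along a lattice -/

section Sampling

open Module Real RealInnerProductSpace

variable {V F : Type*} [NormedAddCommGroup V] [InnerProductSpace ℝ V] [FiniteDimensional ℝ V]
  [MeasurableSpace V] [BorelSpace V]

theorem integral_fourier_smul_eq [NormedAddCommGroup F] [NormedSpace ℂ F] [CompleteSpace F]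
    {φ : V → ℂ} {f : V → F} (hφ : Integrable φ) (hf : Integrable f) :
    ∫ ξ, 𝓕 φ ξ • f ξ = ∫ x, φ x • 𝓕 f x := by
  have := VectorFourier.integral_fourierIntegral_smul_eq_flip (L := innerₗ V)
    continuous_fourierChar continuous_inner hφ hf
  rwa [flip_innerₗ] at this

theorem memLp_two_fourier [NormedAddCommGroup F] [InnerProductSpace ℂ F] [CompleteSpace F]
    {f : V → F} (hf : Integrable f) (hf2 : MemLp f 2) : MemLp (𝓕 f) 2 := by
  let G : Lp (α := V) F 2 := 𝓕 (hf2.toLp f)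
  have hpair (φ : 𝓢(V, ℂ)) : ∫ x, φ x • G x = ∫ x, φ x • 𝓕 f x := by
    have := DFunLike.congr_fun (Lp.fourier_toTemperedDistribution_eq (hf2.toLp f)) φ
    simp only [TemperedDistribution.fourier_apply, Lp.toTemperedDistribution_apply] at this
    rw [← integral_fourier_smul_eq φ.integrable hf, ← SchwartzMap.fourier_coe, ← this]
    exact integral_congr_ae (hf2.coeFn_toLp.mono fun x hx => by simp only [hx])
  have hcont : Continuous (𝓕 f) :=
    VectorFourier.fourierIntegral_continuous continuous_fourierChar continuous_inner hf
  refine (memLp_congr_ae ?_).1 (Lp.memLp G)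
  refine ae_eq_of_integral_contDiff_smul_eq ((Lp.memLp G).locallyIntegrable one_le_two)
    hcont.locallyIntegrable fun ρ hρ hρc => ?_
  have hρ' : HasCompactSupport fun x => (ρ x : ℂ) := hρc.comp_left Complex.ofReal_zero
  have := hpair (hρ'.toSchwartzMap (Complex.ofRealCLM.contDiff.comp hρ))
  change ∫ x, (ρ x : ℂ) • G x = ∫ x, (ρ x : ℂ) • 𝓕 f x at this
  simpa only [Complex.coe_smul] using this

theorem exists_eq_integral_mul_schwartzMap_sub {H : V → ℂ} (hH : Integrable H) (hc : Continuous H)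
    (hsupp : HasCompactSupport (𝓕 H)) :
    ∃ χ : 𝓢(V, ℂ), ∀ x, H x = ∫ s, H s * χ (x - s) := by
  have hFc : Continuous (𝓕 H) :=
    VectorFourier.fourierIntegral_continuous continuous_fourierChar continuous_inner hH
  obtain ⟨R, hR⟩ := hsupp.isCompact.isBounded.exists_norm_le
  obtain ⟨β, hβ, -⟩ := exists_schwartzMap_eq_one_of_norm_le (V := V) R
  have hcut (y : V) : 𝓕 H y = 𝓕 H y * β y := by
    by_cases hy : y ∈ tsupport (𝓕 H)
    · rw [hβ y (hR y hy), mul_one]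
    · rw [image_eq_zero_of_notMem_tsupport hy, zero_mul]
  refine ⟨𝓕⁻ β, fun x => ?_⟩
  have hmod (s : V) : 𝓕 (fun y => 𝐞 ⟪y, x⟫ • β y) s = 𝓕⁻ β (x - s) := by
    rw [SchwartzMap.fourierInv_coe, fourier_eq, fourierInv_eq]
    refine integral_congr_ae (.of_forall fun y => ?_)
    simp only [smul_smul, ← AddChar.map_add_eq_mul, inner_sub_right, neg_add_eq_sub]
  have hint : Integrable fun y => 𝐞 ⟪y, x⟫ • β y := by
    have := (fourierIntegral_convergent_iff (μ := volume) (f := β) (-x)).2 β.integrable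
    simpa only [inner_neg_right, neg_neg] using this
  calc H x = 𝓕⁻ (𝓕 H) x :=
        congr_fun (hc.fourierInv_fourier_eq hH (hFc.integrable_of_hasCompactSupport hsupp)).symm x
    _ = ∫ y, 𝓕 H y • 𝐞 ⟪y, x⟫ • β y := by
        rw [fourierInv_eq]
        refine integral_congr_ae (.of_forall fun y => ?_)
        dsimp only
        rw [smul_comm, smul_eq_mul, ← hcut]
    _ = ∫ s, H s * 𝓕⁻ β (x - s) := by
        rw [integral_fourier_smul_eq hH hint]
        simp only [hmod, smul_eq_mul]

variable {W : Type*} [NormedAddCommGroup W] [NormedSpace ℝ W] [FiniteDimensional ℝ W]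
  {L : Submodule ℤ (V × W)} [DiscreteTopology L] [IsZLattice ℝ L] {r : ℕ}

theorem summable_mul_of_hasCompactSupport_fourier (hr : finrank ℤ L < r) {H : V → ℂ} {ψ : W → ℂ}
    (hH : Integrable H) (hc : Continuous H) (hsupp : HasCompactSupport (𝓕 H))
    (hψ : HasDecay r ψ) :
    Summable fun z : L => H (z : V × W).1 * ψ (z : V × W).2 := by
  obtain ⟨χ, hχ⟩ := exists_eq_integral_mul_schwartzMap_sub hH hc hsupp
  obtain ⟨C, hC⟩ := ((hasDecay_schwartzMap χ).fst_mul_snd hψ).exists_sum_norm_sub_le hr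
  have hint (x : V) : Integrable fun t => ‖H t‖ * ‖χ (x - t)‖ := by
    obtain ⟨M, -, hM⟩ := χ.decay 0 0
    refine hH.norm.mul_bdd (c := M) (by fun_prop) (.of_forall fun t => ?_)
    simpa only [pow_zero, one_mul, norm_iteratedFDeriv_zero, norm_norm] using hM (x - t)
  refine Summable.of_norm (summable_of_sum_le (c := ∫ t, ‖H t‖ * C) (fun _ => norm_nonneg _)
    fun s => ?_)
  calc ∑ z ∈ s, ‖H (z : V × W).1 * ψ (z : V × W).2‖
      ≤ ∑ z ∈ s, (∫ t, ‖H t‖ * ‖χ ((z : V × W).1 - t)‖) * ‖ψ (z : V × W).2‖ := by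
        gcongr with z
        rw [norm_mul]
        gcongr
        rw [hχ]
        simpa only [norm_mul] using norm_integral_le_integral_norm (μ := volume)
          fun t => H t * χ ((z : V × W).1 - t)
    _ = ∫ t, ‖H t‖ * ∑ z ∈ s, ‖χ ((z : V × W).1 - t)‖ * ‖ψ (z : V × W).2‖ := by
        simp only [← integral_mul_const, Finset.mul_sum, ← mul_assoc]
        exact (integral_finsetSum s fun z _ => (hint _).mul_const _).symm
    _ ≤ ∫ t, ‖H t‖ * C := by
        refine integral_mono_of_nonneg (.of_forall fun t => by positivity)
          (hH.norm.mul_const C) (.of_forall fun t => ?_)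
        refine mul_le_mul_of_nonneg_left ?_ (norm_nonneg _)
        refine (Finset.sum_congr rfl fun z _ => ?_).trans_le (hC (t, 0) s)
        change _ = ‖χ ((z : V × W).1 - t) * ψ ((z : V × W).2 - 0)‖
        rw [sub_zero, norm_mul]

end Sampling

/-! ### Radon measures in polar form -/

section Polar

variable {μ : C_c(ℝ, ℂ) → ℂ} {m : Measure ℝ} {u : ℝ → ℂ}

theorem IsPolarDecomposition.locallyIntegrable (h : IsPolarDecomposition μ m u) :
    LocallyIntegrable u m := by
  have := h.finite_on_compacts
  exact (locallyIntegrable_const (1 : ℝ)).mono h.measurable_density.aestronglyMeasurable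
    (.of_forall fun x => by rw [h.norm_density, norm_one])

theorem IsPolarDecomposition.isRadonMeasure (h : IsPolarDecomposition μ m u) :
    IsRadonMeasure μ := by
  have hint (φ : C_c(ℝ, ℂ)) : Integrable (fun x => φ x * u x) m :=
    h.locallyIntegrable.integrable_smul_left_of_hasCompactSupport φ.continuous φ.hasCompactSupport
  refine ⟨⟨fun φ ψ => ?_, fun c φ => ?_⟩, fun K hK => ⟨m.real K, fun φ hφ M hM => ?_⟩⟩
  · simp only [h.apply_eq, CompactlySupportedContinuousMap.add_apply, add_mul]
    exact integral_add (hint φ) (hint ψ)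
  · simp only [h.apply_eq, CompactlySupportedContinuousMap.smul_apply, smul_eq_mul, mul_assoc]
    exact integral_const_mul c _
  · have := h.finite_on_compacts
    rw [h.apply_eq, ← setIntegral_eq_integral_of_forall_compl_eq_zero fun x hx => by
      rw [image_eq_zero_of_notMem_tsupport fun hx' => hx (hφ hx'), zero_mul], mul_comm]
    refine norm_setIntegral_le_of_norm_le_const hK.measure_lt_top fun x _ => ?_
    rw [norm_mul, h.norm_density, mul_one]
    exact hM x

theorem IsPolarDecomposition.eq_zero (h : IsPolarDecomposition 0 m u) : m = 0 := by
  have := h.finite_on_compacts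
  have hu : ∀ᵐ x ∂m, u x = 0 := by
    refine ae_eq_zero_of_integral_contDiff_smul_eq_zero h.locallyIntegrable fun ρ hρ hρc => ?_
    let φ : C_c(ℝ, ℂ) := ⟨⟨fun x => (ρ x : ℂ), Complex.continuous_ofReal.comp hρ.continuous⟩,
      hρc.comp_left Complex.ofReal_zero⟩
    exact (h.apply_eq φ).symm
  have hne (x : ℝ) : u x ≠ 0 := norm_ne_zero_iff.1 (by rw [h.norm_density]; exact one_ne_zero)
  exact ae_eq_bot.1 (Filter.eventually_false_iff_eq_bot.1 (hu.mono fun x hx => hne x hx))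

theorem IsPolarDecomposition.exists_represents [m.HasTemperateGrowth]
    (h : IsPolarDecomposition μ m u) :
    ∃ T : 𝓢'(ℝ, ℂ), (∀ f, T f = ∫ x, f x * u x ∂m) ∧ Represents T μ := by
  have hu : MemLp u ⊤ m := memLp_top_of_bound h.measurable_density.aestronglyMeasurable 1
    (.of_forall fun x => (h.norm_density x).le)
  have hT (f : 𝓢(ℝ, ℂ)) : Lp.toTemperedDistribution (hu.toLp u) f = ∫ x, f x * u x ∂m := by
    rw [Lp.toTemperedDistribution_apply]
    exact integral_congr_ae (hu.coeFn_toLp.mono fun x hx => by simp only [hx, smul_eq_mul])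
  exact ⟨_, hT, fun f φ hf => by simp only [hT, h.apply_eq, hf]⟩

end Polar

/-! ### Weighted Dirac combs -/

section Atomic

variable {ι X : Type*}

/-- The total variation of the weighted Dirac comb `∑ i, c i • δ (p i)`, for an injective `p`. -/
noncomputable def diracCombVariation [MeasurableSpace X] (p : ι → X) (c : ι → ℂ) : Measure X :=
  .sum fun i => ‖c i‖ₑ • .dirac (p i)

/-- The unimodular density of the weighted Dirac comb `∑ i, c i • δ (p i)` with respect to its total
variation; its values off the atoms are irrelevant and set to `1`. -/
noncomputable def diracCombDensity (p : ι → X) (c : ι → ℂ) : X → ℂ :=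
  Function.extend p (fun i => if c i = 0 then 1 else c i / ‖c i‖) 1

variable {p : ι → X} {c : ι → ℂ}

theorem norm_diracCombDensity (hp : p.Injective) (x : X) : ‖diracCombDensity p c x‖ = 1 := by
  by_cases hx : ∃ i, p i = x
  · obtain ⟨i, rfl⟩ := hx
    rw [diracCombDensity, hp.extend_apply]
    split_ifs with hi
    · exact norm_one
    · rw [norm_div, Complex.norm_real, norm_norm, div_self (norm_ne_zero_iff.2 hi)]
  · rw [diracCombDensity, Function.extend_apply' _ _ _ hx, Pi.one_apply, norm_one]

theorem norm_mul_diracCombDensity (hp : p.Injective) (i : ι) :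
    ‖c i‖ * diracCombDensity p c (p i) = c i := by
  rw [diracCombDensity, hp.extend_apply]
  split_ifs with hi
  · simp [hi]
  · exact mul_div_cancel₀ _ (Complex.ofReal_ne_zero.2 (norm_ne_zero_iff.2 hi))

variable [MeasurableSpace X] [MeasurableSingletonClass X] [Countable ι]

theorem integral_mul_diracCombDensity (hp : p.Injective) (F : X → ℂ) :
    ∫ x, F x * diracCombDensity p c x ∂diracCombVariation p c = ∑' i, F (p i) * c i := by
  rw [diracCombVariation, integral_sum_dirac fun i => enorm_ne_top]
  refine tsum_congr fun i => ?_
  rw [toReal_enorm, Complex.real_smul, mul_left_comm, norm_mul_diracCombDensity hp]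

theorem measurable_diracCombDensity : Measurable (diracCombDensity p c) := by
  refine measurable_one.measurable_of_countable_ne ((Set.countable_range p).mono fun x hx => ?_)
  by_contra hxp
  exact hx (Function.extend_apply' _ _ _ hxp).symm

theorem integrable_diracCombVariation {F : X → ℂ} (hF : Summable fun i => F (p i) * c i) :
    Integrable F (diracCombVariation p c) := by
  refine integrable_sum_dirac (fun i => enorm_ne_top) (hF.norm.congr fun i => ?_)
  rw [toReal_enorm, norm_mul, mul_comm]

end Atomic

theorem isPolarDecomposition_diracComb {ι : Type*} [Countable ι] {p : ι → ℝ} {c : ι → ℂ}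
    (hp : p.Injective)
    (hfin : ∀ K, IsCompact K → Summable fun i => K.indicator (1 : ℝ → ℂ) (p i) * c i) :
    IsPolarDecomposition (fun φ => ∑' i, φ (p i) * c i) (diracCombVariation p c)
      (diracCombDensity p c) where
  finite_on_compacts := by
    refine ⟨fun K hK => ?_⟩
    have h := integrable_diracCombVariation (hfin K hK)
    rw [integrable_indicator_iff hK.measurableSet, IntegrableOn, Pi.one_def,
      integrable_const_iff] at h
    simpa [isFiniteMeasure_iff] using h
  measurable_density := measurable_diracCombDensity
  norm_density := norm_diracCombDensity hp
  apply_eq φ := (integral_mul_diracCombDensity hp φ).symm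

/-! ### Weighted model combs -/

section ModelComb

open Module Real

variable {𝓛 : Submodule ℤ (ℝ × ℝ)}

theorem dualSubmodule_prodInner (hdual : dualLattice 𝓛 = 𝓛) :
    (prodInner ℝ ℝ).dualSubmodule 𝓛 = 𝓛 := by
  refine SetLike.coe_injective (Eq.trans (Set.ext fun z => ?_) hdual)
  refine forall₂_congr fun w _ => ?_
  simp only [Submodule.mem_one, prodInner_apply, inner_apply, algebraMap_int_eq, eq_intCast,
    eq_comm]

theorem starMap_fst (hinj : Set.InjOn Prod.fst (𝓛 : Set (ℝ × ℝ))) (z : 𝓛) :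
    starMap 𝓛 (z : ℝ × ℝ).1 = (z : ℝ × ℝ).2 := by
  have hz : ∃ a ∈ (𝓛 : Set (ℝ × ℝ)), a.1 = (z : ℝ × ℝ).1 := ⟨z, z.2, rfl⟩
  rw [starMap, hinj (Function.invFunOn_mem hz) z.2 (Function.invFunOn_eq hz)]

/-- The bijection between a lattice and its projection to physical space. -/
noncomputable def latticeEquivProjL (hinj : Set.InjOn Prod.fst (𝓛 : Set (ℝ × ℝ))) : 𝓛 ≃ projL 𝓛 :=
  Equiv.Set.imageOfInjOn Prod.fst (𝓛 : Set (ℝ × ℝ)) hinj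

theorem coe_latticeEquivProjL (hinj : Set.InjOn Prod.fst (𝓛 : Set (ℝ × ℝ))) (z : 𝓛) :
    (latticeEquivProjL hinj z : ℝ) = (z : ℝ × ℝ).1 := rfl

theorem weightedComb_eq_tsum (hinj : Set.InjOn Prod.fst (𝓛 : Set (ℝ × ℝ))) (g : 𝓢(ℝ, ℂ)) :
    weightedComb 𝓛 g = fun φ => ∑' z : 𝓛, φ (z : ℝ × ℝ).1 * g (z : ℝ × ℝ).2 := by
  ext φ
  rw [weightedComb, ← (latticeEquivProjL hinj).tsum_eq]
  simp only [coe_latticeEquivProjL, starMap_fst hinj, mul_comm]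

theorem weightedComb_smul (c : ℂ) (g : 𝓢(ℝ, ℂ)) :
    weightedComb 𝓛 (c • g) = c • weightedComb 𝓛 g := by
  ext φ
  simp only [weightedComb, Pi.smul_apply, smul_apply, smul_eq_mul, mul_assoc, tsum_mul_left]

variable [DiscreteTopology 𝓛]

theorem countable_lattice : Countable 𝓛 := countable_of_Lindelof_of_discrete

/-- The total variation `|ω_g|` of the weighted Dirac comb `ω_g`. -/
noncomputable abbrev combVariation (𝓛 : Submodule ℤ (ℝ × ℝ)) (g : 𝓢(ℝ, ℂ)) : Measure ℝ :=
  diracCombVariation (fun z : 𝓛 => (z : ℝ × ℝ).1) fun z : 𝓛 => g (z : ℝ × ℝ).2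

/-- The unimodular density of the weighted Dirac comb `ω_g` with respect to `|ω_g|`. -/
noncomputable abbrev combDensity (𝓛 : Submodule ℤ (ℝ × ℝ)) (g : 𝓢(ℝ, ℂ)) : ℝ → ℂ :=
  diracCombDensity (fun z : 𝓛 => (z : ℝ × ℝ).1) fun z : 𝓛 => g (z : ℝ × ℝ).2

theorem integral_mul_combDensity (hinj : Set.InjOn Prod.fst (𝓛 : Set (ℝ × ℝ))) (g : 𝓢(ℝ, ℂ))
    (F : ℝ → ℂ) :
    ∫ x, F x * combDensity 𝓛 g x ∂combVariation 𝓛 g =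
      ∑' z : 𝓛, F (z : ℝ × ℝ).1 * g (z : ℝ × ℝ).2 :=
  have : Countable 𝓛 := countable_lattice
  integral_mul_diracCombDensity hinj.injective F

variable [IsZLattice ℝ 𝓛]

theorem finrank_lattice_lt_three : finrank ℤ 𝓛 < 3 := by
  rw [ZLattice.rank ℝ 𝓛, finrank_prod, finrank_self]
  norm_num

theorem summable_hasDecay_mul {φ : ℝ → ℂ} (hφ : HasDecay 3 φ) (g : 𝓢(ℝ, ℂ)) :
    Summable fun z : 𝓛 => φ (z : ℝ × ℝ).1 * g (z : ℝ × ℝ).2 :=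
  (hφ.fst_mul_snd (hasDecay_schwartzMap g)).summable finrank_lattice_lt_three

theorem summable_weightedComb (hinj : Set.InjOn Prod.fst (𝓛 : Set (ℝ × ℝ))) (g : 𝓢(ℝ, ℂ))
    (φ : C_c(ℝ, ℂ)) :
    Summable fun x : projL 𝓛 => g (starMap 𝓛 x) * φ x := by
  rw [← (latticeEquivProjL hinj).summable_iff]
  simpa only [Function.comp_def, coe_latticeEquivProjL, starMap_fst hinj, mul_comm]
    using summable_hasDecay_mul (hasDecay_compactlySupported φ) g

theorem isPolarDecomposition_weightedComb (hinj : Set.InjOn Prod.fst (𝓛 : Set (ℝ × ℝ)))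
    (g : 𝓢(ℝ, ℂ)) :
    IsPolarDecomposition (weightedComb 𝓛 g) (combVariation 𝓛 g) (combDensity 𝓛 g) := by
  have : Countable 𝓛 := countable_lattice
  rw [weightedComb_eq_tsum hinj]
  refine isPolarDecomposition_diracComb hinj.injective fun K hK =>
    summable_hasDecay_mul (.of_bounded_of_isBounded (M := 1) hK.isBounded (fun x hx => ?_)
      fun x hx => Set.indicator_of_notMem hx _) g
  rw [Set.indicator_of_mem hx, Pi.one_apply, norm_one]

theorem hasTemperateGrowth_combVariation (g : 𝓢(ℝ, ℂ)) :
    (combVariation 𝓛 g).HasTemperateGrowth := by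
  have : Countable 𝓛 := countable_lattice
  let w (x : ℝ) : ℂ := (decayWeight 3 x : ℂ)
  have hnorm (x : ℝ) : ‖w x‖ = decayWeight 3 x :=
    Complex.norm_of_nonneg (decayWeight_pos x).le
  have hw : HasDecay 3 w := ⟨1, fun x => by rw [hnorm, one_mul]⟩
  have hint := (integrable_diracCombVariation (summable_hasDecay_mul (𝓛 := 𝓛) hw g)).norm
  simp only [hnorm, decayWeight] at hint
  exact ⟨3, by simpa [Real.rpow_neg, add_nonneg] using hint⟩

theorem weightedComb_ne_zero (hinj : Set.InjOn Prod.fst (𝓛 : Set (ℝ × ℝ)))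
    (hdense : Dense (Prod.snd '' (𝓛 : Set (ℝ × ℝ)))) {g : 𝓢(ℝ, ℂ)} (hg : g ≠ 0) :
    weightedComb 𝓛 g ≠ 0 := by
  intro h0
  have hvar : combVariation 𝓛 g = 0 :=
    (h0 ▸ isPolarDecomposition_weightedComb hinj g).eq_zero
  have hz (z : 𝓛) : g (z : ℝ × ℝ).2 = 0 := by
    simpa using Measure.sum_eq_zero.1 hvar z
  refine hg (DFunLike.coe_injective (g.continuous.ext_on hdense continuous_zero ?_))
  rintro - ⟨z, hz', rfl⟩
  exact hz ⟨z, hz'⟩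

end ModelComb

/-! ### Fourier transforms of weighted model combs -/

section FourierComb

open Module Real

variable {𝓛 : Submodule ℤ (ℝ × ℝ)} [DiscreteTopology 𝓛] [IsZLattice ℝ 𝓛]

theorem finrank_prod_lt_three : finrank ℝ (ℝ × ℝ) < 3 := by
  rw [finrank_prod, finrank_self]
  norm_num

theorem hasFourierTransform_weightedComb (hinj : Set.InjOn Prod.fst (𝓛 : Set (ℝ × ℝ)))
    (hdual : dualLattice 𝓛 = 𝓛) (g : 𝓢(ℝ, ℂ)) :
    HasFourierTransform (weightedComb 𝓛 g) (weightedComb 𝓛 (𝓕⁻ g)) := by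
  have hpolar (h : 𝓢(ℝ, ℂ)) := isPolarDecomposition_weightedComb hinj h
  have hdistr (h : 𝓢(ℝ, ℂ)) : ∃ T : 𝓢'(ℝ, ℂ),
      (∀ f, T f = ∑' z : 𝓛, f (z : ℝ × ℝ).1 * h (z : ℝ × ℝ).2) ∧
        Represents T (weightedComb 𝓛 h) := by
    have := hasTemperateGrowth_combVariation (𝓛 := 𝓛) h
    simpa only [integral_mul_combDensity hinj] using (hpolar h).exists_represents
  obtain ⟨T, hT, hTg⟩ := hdistr g
  obtain ⟨T', hT', hTg'⟩ := hdistr (𝓕⁻ g)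
  have hTT' : 𝓕 T = T' := by
    ext f
    rw [TemperedDistribution.fourier_apply, hT, hT']
    have hsum := summable_schwartzMap_mul (L := 𝓛) (𝓕⁻ (𝓕 f)) (𝓕⁻ g)
    have := tsum_mul_eq_tsum_fourierInv_mul (dualSubmodule_prodInner hdual) finrank_prod_lt_three
      (hasDecay_schwartzMap (𝓕 f)) (hasDecay_schwartzMap g) (𝓕 f).continuous g.continuous
    simp only [← SchwartzMap.fourierInv_coe] at this
    rw [this hsum, FourierTransform.fourierInv_fourier_eq]
  exact ⟨(hpolar g).isRadonMeasure, (hpolar _).isRadonMeasure, T, hTg, hTT' ▸ hTg'⟩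

theorem fourier_tilde (f : C_c(ℝ, ℂ)) (y : ℝ) :
    𝓕 (tilde f : ℝ → ℂ) y = conj (𝓕 (f : ℝ → ℂ) y) := by
  rw [fourier_eq', fourier_eq', ← integral_conj, ← integral_neg_eq_self]
  congr 1 with t
  have ht : tilde f (-t) = conj (f t) := congrArg (conj ∘ f) (neg_neg t)
  simp only [smul_eq_mul, map_mul, ht, ← Complex.exp_conj, Complex.conj_ofReal, Complex.conj_I,
    inner_neg_left]
  congr 2
  push_cast
  ring

theorem integrable_compactlySupported (f : C_c(ℝ, ℂ)) : Integrable f :=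
  f.continuous.integrable_of_hasCompactSupport f.hasCompactSupport

theorem fourierInv_conv_tilde (f : C_c(ℝ, ℂ)) (y : ℝ) :
    𝓕⁻ (conv f (tilde f) : ℝ → ℂ) y = ((‖𝓕⁻ (f : ℝ → ℂ) y‖ ^ 2 : ℝ) : ℂ) := by
  have hconv : 𝓕 (conv f (tilde f) : ℝ → ℂ) (-y) = 𝓕 (f : ℝ → ℂ) (-y) * 𝓕 (tilde f : ℝ → ℂ) (-y) :=
    fourier_mul_convolution_eq (integrable_compactlySupported f)
      (integrable_compactlySupported (tilde f)) (-y)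
  rw [fourierInv_eq_fourier_neg, fourierInv_eq_fourier_neg, hconv, fourier_tilde, Complex.mul_conj',
    Complex.ofReal_pow]

theorem integrable_fourierInv_conv_tilde (f : C_c(ℝ, ℂ)) :
    Integrable (𝓕⁻ (conv f (tilde f) : ℝ → ℂ)) := by
  have hL2 : MemLp (𝓕 (f : ℝ → ℂ)) 2 :=
    memLp_two_fourier (integrable_compactlySupported f)
      (f.continuous.memLp_of_hasCompactSupport f.hasCompactSupport)
  have hsq : Integrable fun y => ‖𝓕⁻ (f : ℝ → ℂ) y‖ ^ 2 := by
    simpa only [fourierInv_eq_fourier_neg] using (hL2.integrable_norm_pow two_ne_zero).comp_neg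
  rw [funext (fourierInv_conv_tilde f)]
  exact hsq.ofReal

theorem summable_fourierInv_conv_tilde_mul (f : C_c(ℝ, ℂ)) (g : 𝓢(ℝ, ℂ)) :
    Summable fun z : 𝓛 => 𝓕⁻ (conv f (tilde f) : ℝ → ℂ) (z : ℝ × ℝ).1 * g (z : ℝ × ℝ).2 := by
  set h := conv f (tilde f)
  have hh := integrable_compactlySupported h
  have hint : Integrable (𝓕⁻ (h : ℝ → ℂ)) := integrable_fourierInv_conv_tilde f
  have hcont : Continuous (𝓕⁻ (h : ℝ → ℂ)) := by
    rw [funext (fourierInv_eq_fourier_neg h)]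
    exact (VectorFourier.fourierIntegral_continuous continuous_fourierChar continuous_inner hh).comp
      continuous_neg
  have hint' : Integrable (𝓕 (h : ℝ → ℂ)) := by
    simpa only [fourierInv_eq_fourier_neg, neg_neg] using hint.comp_neg
  refine summable_mul_of_hasCompactSupport_fourier finrank_lattice_lt_three hint hcont ?_
    (hasDecay_schwartzMap g)
  rw [Continuous.fourier_fourierInv_eq (map_continuous h) hh hint']
  exact h.hasCompactSupport

theorem hasStrictFourierTransform_weightedComb (hinj : Set.InjOn Prod.fst (𝓛 : Set (ℝ × ℝ)))
    (hdual : dualLattice 𝓛 = 𝓛) (g : 𝓢(ℝ, ℂ)) :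
    HasStrictFourierTransform (weightedComb 𝓛 g) (weightedComb 𝓛 (𝓕⁻ g)) := by
  have := countable_lattice (𝓛 := 𝓛)
  have hpolar (h : 𝓢(ℝ, ℂ)) := isPolarDecomposition_weightedComb hinj h
  refine ⟨(hpolar g).isRadonMeasure, (hpolar _).isRadonMeasure, _, _, hpolar _, fun f => ?_⟩
  have hsum := summable_fourierInv_conv_tilde_mul (𝓛 := 𝓛) f (𝓕⁻ g)
  constructor
  · have := (integrable_diracCombVariation hsum).norm
    simpa [fourierInv_conv_tilde] using this
  · simp only [← fourierInv_conv_tilde]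
    rw [integral_mul_combDensity hinj, weightedComb_eq_tsum hinj]
    rw [SchwartzMap.fourierInv_coe] at hsum ⊢
    exact tsum_mul_eq_tsum_fourierInv_mul (dualSubmodule_prodInner hdual) finrank_prod_lt_three
      (hasDecay_compactlySupported _) (hasDecay_schwartzMap g) (conv f (tilde f)).continuous
      g.continuous hsum

end FourierComb

/-! ### Eigenvalues of the Fourier transform on Schwartz functions -/

section Eigenvalue

variable {V E : Type*} [NormedAddCommGroup V] [InnerProductSpace ℝ V] [FiniteDimensional ℝ V]
  [MeasurableSpace V] [BorelSpace V] [NormedAddCommGroup E] [NormedSpace ℂ E] [CompleteSpace E]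
  {g : 𝓢(V, E)} {lam : ℂ}

theorem smul_fourierInv_eq_self (hlam : 𝓕 g = lam • g) : lam • 𝓕⁻ g = g := by
  rw [← FourierTransform.fourierInv_smul, ← hlam, FourierTransform.fourierInv_fourier_eq]

theorem eq_sq_smul_comp_neg (hlam : 𝓕 g = lam • g) (x : V) : g x = lam ^ 2 • g (-x) := by
  have hneg : 𝓕⁻ g x = 𝓕 g (-x) := by
    rw [SchwartzMap.fourierInv_coe, SchwartzMap.fourier_coe, Real.fourierInv_eq_fourier_neg]
  calc g x = lam • 𝓕⁻ g x := (DFunLike.congr_fun (smul_fourierInv_eq_self hlam) x).symm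
    _ = lam ^ 2 • g (-x) := by rw [hneg, hlam, smul_apply, smul_smul, sq]

theorem eigenvalue_pow_four (hg : g ≠ 0) (hlam : 𝓕 g = lam • g) : lam ^ 4 = 1 := by
  obtain ⟨x, hx⟩ := DFunLike.ne_iff.1 hg
  have htwice : lam ^ 4 • g x = (1 : ℂ) • g x :=
    calc lam ^ 4 • g x = lam ^ 2 • lam ^ 2 • g (- -x) := by
          rw [neg_neg, smul_smul, ← pow_add]
      _ = (1 : ℂ) • g x := by
          rw [← eq_sq_smul_comp_neg hlam, ← eq_sq_smul_comp_neg hlam, one_smul]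
  exact smul_left_injective ℂ hx htwice

theorem mem_of_pow_four_eq_one {z : ℂ} (hz : z ^ 4 = 1) :
    z ∈ ({1, Complex.I, -1, -Complex.I} : Set ℂ) := by
  have hprod : (z - 1) * (z - Complex.I) * (z + 1) * (z + Complex.I) = 0 := by
    linear_combination hz - (z ^ 2 - 1) * Complex.I_sq
  simpa [mul_eq_zero, sub_eq_zero, add_eq_zero_iff_eq_neg, or_assoc] using hprod

theorem fourierInv_eq_conj_smul (hg : g ≠ 0) (hlam : 𝓕 g = lam • g) : 𝓕⁻ g = conj lam • g := by
  have hnorm : ‖lam‖ = 1 :=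
    Complex.norm_eq_one_of_pow_eq_one (eigenvalue_pow_four hg hlam) four_ne_zero
  have hne : lam ≠ 0 := norm_ne_zero_iff.1 (hnorm ▸ one_ne_zero)
  rw [← Complex.inv_eq_conj hnorm, eq_inv_smul_iff₀ hne, smul_fourierInv_eq_self hlam]

end Eigenvalue

end FourierEigenmeasure

theorem corollary5p2 (𝓛 : Submodule ℤ (ℝ × ℝ))
    (hcps : FourierEigenmeasure.IsCutAndProjectScheme 𝓛)
    (hdual : FourierEigenmeasure.dualLattice 𝓛 = (𝓛 : Set (ℝ × ℝ)))
    (g : 𝓢(ℝ, ℂ)) (hg : g ≠ 0) (lam : ℂ) (hlam : 𝓕 g = lam • g) :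
    lam ∈ ({1, Complex.I, -1, -Complex.I} : Set ℂ) ∧
    (∀ φ : C_c(ℝ, ℂ), Summable fun x : FourierEigenmeasure.projL 𝓛 =>
      g (FourierEigenmeasure.starMap 𝓛 x) * φ x) ∧
    FourierEigenmeasure.IsEigenmeasure
      (FourierEigenmeasure.weightedComb 𝓛 g) (conj lam) ∧
    FourierEigenmeasure.IsStrictEigenmeasure
      (FourierEigenmeasure.weightedComb 𝓛 g) (conj lam) := by
  open FourierEigenmeasure in
  obtain ⟨_, _, hinj, hdense⟩ := hcps
  have hcomb : weightedComb 𝓛 (𝓕⁻ g) = conj lam • weightedComb 𝓛 g := by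
    rw [fourierInv_eq_conj_smul hg hlam, weightedComb_smul]
  have hfourier := hcomb ▸ hasFourierTransform_weightedComb hinj hdual g
  have hstrict := hcomb ▸ hasStrictFourierTransform_weightedComb hinj hdual g
  have htempered : IsTemperedMeasure (weightedComb 𝓛 g) :=
    let ⟨hradon, _, T, hT, _⟩ := hfourier
    ⟨hradon, T, hT⟩
  have heigen : IsEigenmeasure (weightedComb 𝓛 g) (conj lam) :=
    ⟨htempered, weightedComb_ne_zero hinj hdense hg, hfourier⟩
  exact ⟨mem_of_pow_four_eq_one (eigenvalue_pow_four hg hlam), summable_weightedComb hinj g,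
    heigen, heigen, hstrict⟩
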